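/- For every integer $c\ge 1$ there is a polynomial $P$ (with integer coefficients, depending only on $c$) such that the following holds. Let $r\ge 0$ be an integer, let $F_r$ be the free group on $x_1,\dots,x_r$, let $\gamma_1(G)=G$, $\gamma_{i+1}(G)=[\gamma_i(G),G]$ denote the lower central series of a group $G$, and let $N=N_{r,c}=F_r/\gamma_{c+1}(F_r)$ be the free nilpotent group of rank $r$ and class $c$. Iterated commutators in $N$ are defined inductively: each $x_i$ is one of weight $1$; the inverse of an iterated commutator of weight $n$ is one of weight $n$; and if $g,h$ are iterated commutators of weights $a,b$, then $[g,h]=ghg^{-1}h^{-1}$ is one of weight $a+b$. Let $y_1,\dots,y_m$ be any Malcev basis of iterated commutators for $N$, that is, a list of iterated commutators with assigned weights between $1$ and $c$, ordered by non-decreasing weight, beginning with $y_1=x_1,\dots,y_r=x_r$ (of weight $1$), and such that for each $1\le i\le c$ the members of the list of weight $i$ lie in $\gamma_i(N)$ and their classes form a basis of the free abelian group $\gamma_i(N)/\gamma_{i+1}(N)$. Then for every group word $w$ (not necessarily reduced) in $x_1^{\pm1},\dots,x_r^{\pm1}$, of length $|w|$, there are integers $\alpha_1,\dots,\alpha_m$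 such that $$w=y_1^{\alpha_1}y_2^{\alpha_2}\cdots y_m^{\alpha_m}\ \text{ in } N_{r,c}\qquad\text{and}\qquad |\alpha_i|\le P(|w|)\ \text{ for } i=1,\dots,m.$$ -/

import Mathlib

/-- The `n`-th factor `γ_{n+1}(G) / γ_{n+2}(G)` of the lower central series of `G`.
Mathlib numbers the lower central series from zero: `lowerCentralSeries ⊤ n` is the group
usually written `γ_{n+1}(G)`, with `γ_1(G) = G`. -/
abbrev LCSFactor (G : Type*) [Group G] (n : ℕ) : Type _ :=
  ↥((⊤ : Subgroup G).lowerCentralSeries n) ⧸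
    ((⊤ : Subgroup G).lowerCentralSeries (n + 1)).subgroupOf
      ((⊤ : Subgroup G).lowerCentralSeries n)

/-- The factors of the lower central series are abelian (for their usual quotient group
structure). -/
instance LCSFactor.instCommGroup (G : Type*) [Group G] (n : ℕ) : CommGroup (LCSFactor G n) where
  __ := (inferInstance : Group (LCSFactor G n))
  mul_comm a b := by
    induction a using QuotientGroup.induction_on with | _ a => ?_
    induction b using QuotientGroup.induction_on with | _ b => ?_
    rw [← QuotientGroup.mk_mul, ← QuotientGroup.mk_mul, QuotientGroup.eq,
      Subgroup.mem_subgroupOf]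
    have h := Subgroup.commutator_mem_commutator
      (inv_mem b.2) (Subgroup.mem_top ((a : G)⁻¹))
    simpa [commutatorElement_def, mul_assoc] using h

/-- The free nilpotent group `N_{r,c} = F_r / γ_{c+1}(F_r)` of rank `r` and class `c`. -/
abbrev FreeNilpotentGroup (r c : ℕ) : Type :=
  FreeGroup (Fin r) ⧸ (⊤ : Subgroup (FreeGroup (Fin r))).lowerCentralSeries c

namespace FreeNilpotentGroup

/-- The element of `N_{r,c}` represented by a group word in `x_1^{±1}, …, x_r^{±1}`. A word is
a list of letters, not necessarily reduced: `(i, true)` is `x_i`, `(i, false)` is `x_i⁻¹`. -/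
def ofWord {r : ℕ} (c : ℕ) (w : List (Fin r × Bool)) : FreeNilpotentGroup r c :=
  QuotientGroup.mk (FreeGroup.mk w)

/-- The free generator `x_i` of `N_{r,c}`. -/
def gen {r : ℕ} (c : ℕ) (i : Fin r) : FreeNilpotentGroup r c :=
  QuotientGroup.mk (FreeGroup.of i)

end FreeNilpotentGroup

/-- `IsIteratedCommutator x n g`: the element `g` is an iterated commutator of weight `n` in the
elements `x i` and their inverses. Commutators may be bracketed arbitrarily and inverses may be
taken at every stage (without changing the weight). So this includes the left-normed
`[…[[x_{i₁}^{±1}, x_{i₂}^{±1}], x_{i₃}^{±1}], …, x_{iₙ}^{±1}]^{±1}` as well as the basic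
commutators of Hall, for either convention `[a, b] = a b a⁻¹ b⁻¹` or `[a, b] = a⁻¹ b⁻¹ a b`. -/
inductive IsIteratedCommutator {G ι : Type*} [Group G] (x : ι → G) : ℕ → G → Prop
  | gen (i : ι) : IsIteratedCommutator x 1 (x i)
  | inv {n : ℕ} {g : G} (hg : IsIteratedCommutator x n g) : IsIteratedCommutator x n g⁻¹
  | comm {a b : ℕ} {g h : G} (hg : IsIteratedCommutator x a g) (hh : IsIteratedCommutator x b h) :
      IsIteratedCommutator x (a + b) (g * h * g⁻¹ * h⁻¹)

/-- `y_1, …, y_m` (here indexed by `Fin m`), with weights `wt`, is a Malcev basis of iterated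
commutators for `N_{r,c}`. -/
structure IsMalcevBasis {r c m : ℕ} (wt : Fin m → ℕ) (y : Fin m → FreeNilpotentGroup r c) :
    Prop where
  /-- The list is ordered by weight. -/
  monotone_wt : Monotone wt
  /-- The weights do not exceed the class. -/
  wt_le : ∀ j, wt j ≤ c
  /-- `y_j` is an iterated commutator of weight `wt j` in the free generators. -/
  isIteratedCommutator : ∀ j, IsIteratedCommutator (FreeNilpotentGroup.gen c) (wt j) (y j)
  /-- The list starts with `y_1 = x_1, …, y_r = x_r`, of weight one. -/
  eq_gen : ∀ i : Fin r, ∃ h : (i : ℕ) < m,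
    wt ⟨i, h⟩ = 1 ∧ y ⟨i, h⟩ = FreeNilpotentGroup.gen c i
  /-- For `1 ≤ n + 1 ≤ c`, the `y_j` of weight `n + 1` lie in `γ_{n+1}` and their classes form a
  basis of the abelian group (written additively) `γ_{n+1} / γ_{n+2}`. -/
  basis : ∀ n < c,
    ∃ b : Module.Basis {j : Fin m // wt j = n + 1} ℤ
        (Additive (LCSFactor (FreeNilpotentGroup r c) n)),
      ∀ j : {j : Fin m // wt j = n + 1},
        ∃ h : y j ∈ (⊤ : Subgroup (FreeNilpotentGroup r c)).lowerCentralSeries n,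
        b j = Additive.ofMul (QuotientGroup.mk ⟨y j, h⟩)

/-! This is Hall's collection process with two quantitative controls. A word is a product of
commutators of weight 1. For each weight in turn, the letters of that weight are rewritten in the
basis and moved to the front in order; each crossing inserts one commutator of larger weight, and
weights above the class are trivial.

The rewriting cost must not depend on the rank or on the basis. A commutator of weight `i ≤ c`
involves at most `i` generators, so retracting onto these reduces to ranks at most `c`, where there
are finitely many commutators and finitely many images of the basis
(`IsMalcevBasis.exists_list_bound`).

For the crossings, a letter of weight `k` is charged `B ^ (-k)`. Moving one letter forward
multiplies the total charge by at most `1 + 1/B` (`exists_move_front`). If `B` is at least the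
number of moves, the total factor is at most `e`, while charge and length differ by at most the
factor `B ^ c` (`exists_collect`). Each weight thus costs a polynomial, and there are only `c`
weights. -/

namespace Subgroup

/-! ### Commutators of lower central series terms -/

variable {G : Type*} [Group G]

theorem commutator_commutator_le_of_rotate {H₁ H₂ H₃ N : Subgroup G} [N.Normal]
    (h₁ : ⁅⁅H₂, H₃⁆, H₁⁆ ≤ N) (h₂ : ⁅⁅H₃, H₁⁆, H₂⁆ ≤ N) : ⁅⁅H₁, H₂⁆, H₃⁆ ≤ N := by
  have key : ∀ K : Subgroup G, K ≤ N ↔ K.map (QuotientGroup.mk' N) = ⊥ := fun K => by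
    rw [Subgroup.map_eq_bot_iff, QuotientGroup.ker_mk']
  rw [key, map_commutator, map_commutator] at *
  exact commutator_commutator_eq_bot_of_rotate h₁ h₂

/-- Induction on `n` through the three subgroups lemma; the `+ 1` is due to numbering from zero. -/
theorem commutator_top_lowerCentralSeries_le (m n : ℕ) :
    ⁅(⊤ : Subgroup G).lowerCentralSeries m, (⊤ : Subgroup G).lowerCentralSeries n⁆ ≤
      (⊤ : Subgroup G).lowerCentralSeries (m + n + 1) := by
  induction n generalizing m with
  | zero => exact le_rfl
  | succ n ih =>
    rw [commutator_comm, lowerCentralSeries_succ]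
    refine commutator_commutator_le_of_rotate ?_ ?_
    · rw [commutator_comm ⊤]
      exact (ih (m + 1)).trans_eq (by congr 1; omega)
    · exact (commutator_mono (ih m) le_rfl).trans_eq rfl

end Subgroup

/-! ### Iterated commutators and the lower central series -/

namespace IsIteratedCommutator

variable {G H ι κ : Type*} [Group G] [Group H] {x : ι → G}

theorem one_le {n : ℕ} {g : G} (hg : IsIteratedCommutator x n g) : 1 ≤ n := by
  induction hg with
  | gen i => exact le_rfl
  | inv _ ih => exact ih
  | comm _ _ ih _ => omega

theorem mem_lowerCentralSeries {n : ℕ} {g : G} (hg : IsIteratedCommutator x n g) :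
    g ∈ (⊤ : Subgroup G).lowerCentralSeries (n - 1) := by
  induction hg with
  | gen i => trivial
  | inv _ ih => exact inv_mem ih
  | @comm a b g h hg hh ihg ihh =>
    have := Subgroup.commutator_top_lowerCentralSeries_le _ _
      (Subgroup.commutator_mem_commutator ihg ihh)
    rw [commutatorElement_def] at this
    have ha := hg.one_le
    have hb := hh.one_le
    rwa [show a - 1 + (b - 1) + 1 = a + b - 1 by omega] at this

theorem eq_one_of_lt {c : ℕ} (hc : (⊤ : Subgroup G).lowerCentralSeries c = ⊥) {n : ℕ} {g : G}
    (hg : IsIteratedCommutator x n g) (hn : c < n) : g = 1 := by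
  rw [← Subgroup.mem_bot, ← hc]
  exact Subgroup.lowerCentralSeries_antitone _ (by omega : c ≤ n - 1) hg.mem_lowerCentralSeries

theorem map (f : G →* H) {n : ℕ} {g : G} (hg : IsIteratedCommutator x n g) :
    IsIteratedCommutator (f ∘ x) n (f g) := by
  induction hg with
  | gen i => exact gen (x := f ∘ x) i
  | inv _ ih => rw [map_inv]; exact ih.inv
  | comm _ _ ihg ihh => simp only [map_mul, map_inv]; exact ihg.comm ihh

theorem of_comp {e : κ → ι} {n : ℕ} {g : G} (hg : IsIteratedCommutator (x ∘ e) n g) :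
    IsIteratedCommutator x n g := by
  induction hg with
  | gen i => exact gen (x := x) (e i)
  | inv _ ih => exact ih.inv
  | comm _ _ ihg ihh => exact ihg.comm ihh

theorem exists_of_map (f : G →* H) {n : ℕ} {h : H} (hh : IsIteratedCommutator (f ∘ x) n h) :
    ∃ g, IsIteratedCommutator x n g ∧ f g = h := by
  induction hh with
  | gen i => exact ⟨x i, gen i, rfl⟩
  | inv _ ih => obtain ⟨g, hg, rfl⟩ := ih; exact ⟨g⁻¹, hg.inv, map_inv f g⟩
  | comm _ _ ihg ihh =>
    obtain ⟨g, hg, rfl⟩ := ihg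
    obtain ⟨h, hh, rfl⟩ := ihh
    exact ⟨_, hg.comm hh, by simp⟩

/-- `S` collects the generators occurring in one expression of `g`. This is the source of
independence from the rank. -/
theorem exists_finset_support [DecidableEq ι] {n : ℕ} {g : G} (hg : IsIteratedCommutator x n g) :
    ∃ S : Finset ι, S.card ≤ n ∧ ∀ (k : ℕ) (e : Fin k → ι), ↑S ⊆ Set.range e →
      IsIteratedCommutator (x ∘ e) n g := by
  induction hg with
  | gen i =>
    refine ⟨{i}, by simp, fun k e he => ?_⟩
    obtain ⟨a, rfl⟩ := he (by simp : i ∈ _)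
    exact gen (x := x ∘ e) a
  | inv _ ih =>
    obtain ⟨S, hS, h⟩ := ih
    exact ⟨S, hS, fun k e he => (h k e he).inv⟩
  | comm _ _ ihg ihh =>
    obtain ⟨S, hS, h⟩ := ihg
    obtain ⟨S', hS', h'⟩ := ihh
    refine ⟨S ∪ S', (Finset.card_union_le _ _).trans (by omega), fun k e he => ?_⟩
    rw [Finset.coe_union, Set.union_subset_iff] at he
    exact (h k e he.1).comm (h' k e he.2)

/-- Up to inversion, such an element is a generator or a commutator of two elements of strictly
smaller weights. -/
theorem finite [Finite ι] (x : ι → G) (n : ℕ) : {g | IsIteratedCommutator x n g}.Finite := by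
  induction n using Nat.strong_induction_on with
  | _ n ih =>
    have hB : (Set.range x ∪ ⋃ a ∈ Set.Iio n, ⋃ b ∈ Set.Iio n,
        Set.image2 (fun g h => g * h * g⁻¹ * h⁻¹) {g | IsIteratedCommutator x a g}
          {g | IsIteratedCommutator x b g}).Finite :=
      (Set.finite_range x).union <| (Set.finite_Iio n).biUnion fun a ha =>
        (Set.finite_Iio n).biUnion fun b hb => (ih a ha).image2 _ (ih b hb)
    refine (hB.union hB.inv).subset fun g hg => ?_
    rw [Set.mem_ofPred_eq] at hg
    clear ih hB
    induction hg with
    | gen i => exact Or.inl (Or.inl ⟨i, rfl⟩)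
    | inv _ ih => exact ih.symm.imp Set.mem_inv.1 Set.inv_mem_inv.2
    | comm hg hh _ _ =>
      refine Or.inl (Or.inr ?_)
      have ha := hg.one_le
      have hb := hh.one_le
      simp only [Set.mem_iUnion]
      exact ⟨_, Set.mem_Iio.2 (by omega), _, Set.mem_Iio.2 (by omega), _, hg, _, hh, rfl⟩

theorem exists_list_of_mem_closure {s : Set G} {g : G} (hg : g ∈ Subgroup.closure s) :
    ∃ l : List G, l.prod = g ∧ ∀ a ∈ l, a ∈ s ∨ a⁻¹ ∈ s := by
  induction hg using Subgroup.closure_induction with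
  | mem a ha => exact ⟨[a], by simp, by simp [ha]⟩
  | one => exact ⟨[], by simp, by simp⟩
  | mul a b _ _ iha ihb =>
    obtain ⟨l, rfl, hl⟩ := iha
    obtain ⟨l', rfl, hl'⟩ := ihb
    exact ⟨l ++ l', by simp, fun a ha => (List.mem_append.1 ha).elim (hl a) (hl' a)⟩
  | inv a _ iha =>
    obtain ⟨l, rfl, hl⟩ := iha
    refine ⟨(l.map Inv.inv).reverse, (List.prod_inv_reverse l).symm, fun a ha => ?_⟩
    simp only [List.mem_reverse, List.mem_map] at ha
    obtain ⟨b, hb, rfl⟩ := ha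
    simpa [or_comm] using hl b hb

/-- The subgroup generated by the iterated commutators of weight at least `n`. -/
def closureGE (x : ι → G) (n : ℕ) : Subgroup G :=
  Subgroup.closure {g | ∃ k, n ≤ k ∧ IsIteratedCommutator x k g}

theorem mem_closureGE {n k : ℕ} {g : G} (hg : IsIteratedCommutator x k g) (h : n ≤ k) :
    g ∈ closureGE x n :=
  Subgroup.subset_closure ⟨k, h, hg⟩

theorem conj_mem_closureGE {n : ℕ} {t h : G} (ht : IsIteratedCommutator x 1 t)
    (hh : h ∈ closureGE x n) : t * h * t⁻¹ ∈ closureGE x n := by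
  induction hh using Subgroup.closure_induction with
  | mem h hh =>
    obtain ⟨k, hk, hh⟩ := hh
    rw [show t * h * t⁻¹ = (t * h * t⁻¹ * h⁻¹) * h by group]
    exact mul_mem (mem_closureGE (ht.comm hh) (by omega)) (mem_closureGE hh hk)
  | one => simp
  | mul a b _ _ iha ihb =>
    rw [show t * (a * b) * t⁻¹ = (t * a * t⁻¹) * (t * b * t⁻¹) by group]
    exact mul_mem iha ihb
  | inv a _ iha =>
    rw [show t * a⁻¹ * t⁻¹ = (t * a * t⁻¹)⁻¹ by group]
    exact inv_mem iha

theorem closureGE_normal (hx : Subgroup.closure (Set.range x) = ⊤) (n : ℕ) :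
    (closureGE x n).Normal := by
  refine ⟨fun h hh g => ?_⟩
  have hg : g ∈ Subgroup.closure (Set.range x) := hx ▸ Subgroup.mem_top g
  obtain ⟨l, rfl, hl⟩ := exists_list_of_mem_closure hg
  clear hg
  induction l with
  | nil => simpa using hh
  | cons a l ih =>
    have ha : IsIteratedCommutator x 1 a := by
      rcases hl a (by simp) with ⟨i, hi⟩ | ⟨i, hi⟩
      · exact hi ▸ gen i
      · rw [← inv_inv a, ← hi]; exact (gen i).inv
    have := conj_mem_closureGE ha (ih fun b hb => hl b (by simp [hb]))
    simpa [mul_assoc] using this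

/-- Modulo the next closure, which is normal, commutators of weight at least `n + 1` commute with
the generators of the group, hence are central. -/
theorem lowerCentralSeries_le_closureGE (hx : Subgroup.closure (Set.range x) = ⊤) (n : ℕ) :
    (⊤ : Subgroup G).lowerCentralSeries n ≤ closureGE x (n + 1) := by
  induction n with
  | zero =>
    rw [Subgroup.lowerCentralSeries_zero, ← hx, Subgroup.closure_le]
    rintro _ ⟨i, rfl⟩
    exact mem_closureGE (gen i) le_rfl
  | succ n ih =>
    have := closureGE_normal hx (n + 1 + 1)
    rw [Subgroup.lowerCentralSeries_succ, Subgroup.commutator_le]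
    intro h hh g _
    have hg : g ∈ Subgroup.closure (Set.range x) := hx ▸ Subgroup.mem_top g
    replace hh := ih hh
    suffices Commute (QuotientGroup.mk' (closureGE x (n + 1 + 1)) h)
        (QuotientGroup.mk' (closureGE x (n + 1 + 1)) g) by
      rw [← commutatorElement_eq_one_iff_commute, ← map_commutatorElement] at this
      exact (QuotientGroup.eq_one_iff _).1 this
    induction hh using Subgroup.closure_induction with
    | mem h hh =>
      obtain ⟨k, hk, hh⟩ := hh
      induction hg using Subgroup.closure_induction with
      | mem g hg =>
        obtain ⟨i, rfl⟩ := hg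
        rw [← commutatorElement_eq_one_iff_commute, ← map_commutatorElement]
        exact (QuotientGroup.eq_one_iff _).2 (mem_closureGE (hh.comm (gen i)) (by omega))
      | one => simp
      | mul a b _ _ iha ihb => rw [map_mul]; exact (iha trivial).mul_right (ihb trivial)
      | inv a _ iha => rw [map_inv]; exact (iha trivial).inv_right
    | one => simp
    | mul a b _ _ iha ihb => rw [map_mul]; exact iha.mul_left ihb
    | inv a _ iha => rw [map_inv]; exact iha.inv_left

end IsIteratedCommutator

/-! ### Generators, class and universal property of the free nilpotent group -/

namespace FreeNilpotentGroup

variable {r c : ℕ}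

theorem closure_range_gen : Subgroup.closure (Set.range (gen c : Fin r → _)) = ⊤ := by
  have : Set.range (gen c : Fin r → _) =
      QuotientGroup.mk' ((⊤ : Subgroup (FreeGroup (Fin r))).lowerCentralSeries c) ''
        Set.range FreeGroup.of := by
    rw [← Set.range_comp]; rfl
  rw [this, ← MonoidHom.map_closure, FreeGroup.closure_range_of, ← MonoidHom.range_eq_map,
    MonoidHom.range_eq_top]
  exact QuotientGroup.mk'_surjective _

theorem lowerCentralSeries_eq_bot :
    (⊤ : Subgroup (FreeNilpotentGroup r c)).lowerCentralSeries c = ⊥ := by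
  have h := Subgroup.map_lowerCentralSeries ⊤
    (QuotientGroup.mk' ((⊤ : Subgroup (FreeGroup (Fin r))).lowerCentralSeries c)) c
  rw [← MonoidHom.range_eq_map, MonoidHom.range_eq_top.2 (QuotientGroup.mk'_surjective _)] at h
  rw [← h, Subgroup.map_eq_bot_iff, QuotientGroup.ker_mk']

/-- The homomorphism from `N_{r,c}` to a group of class at most `c` with given images of the free
generators. -/
def lift {H : Type*} [Group H] (hH : (⊤ : Subgroup H).lowerCentralSeries c = ⊥) (e : Fin r → H) :
    FreeNilpotentGroup r c →* H :=
  QuotientGroup.lift _ (FreeGroup.lift e) fun g hg => by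
    rw [MonoidHom.mem_ker, ← Subgroup.mem_bot, ← hH]
    refine Subgroup.lowerCentralSeries_mono c
      (le_top : (⊤ : Subgroup _).map (FreeGroup.lift e) ≤ ⊤) ?_
    beta_reduce
    rw [← Subgroup.map_lowerCentralSeries]
    exact Subgroup.mem_map_of_mem (FreeGroup.lift e) hg

@[simp] theorem lift_gen {H : Type*} [Group H]
    (hH : (⊤ : Subgroup H).lowerCentralSeries c = ⊥) (e : Fin r → H) (i : Fin r) :
    lift hH e (gen c i) = e i :=
  FreeGroup.lift_apply_of

end FreeNilpotentGroup

/-! ### Uniform length bounds and retractions -/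

namespace IsIteratedCommutator

open Filter

/-- There are finitely many pairs `(B, g)`, and each needs only some list, so every large `K` serves
them all. -/
theorem exists_length_bound {G ι : Type*} [Group G] [Finite ι] (x : ι → G) (i : ℕ) :
    ∀ᶠ K in atTop, ∀ B ⊆ {g | IsIteratedCommutator x i g}, ∀ g, IsIteratedCommutator x i g →
      g ∈ Subgroup.closure (B ∪ {a | ∃ k, i < k ∧ IsIteratedCommutator x k a}) →
      ∃ l : List G, l.prod = g ∧ l.length ≤ K ∧
        ∀ a ∈ l, a ∈ B ∨ a⁻¹ ∈ B ∨ ∃ k, i < k ∧ IsIteratedCommutator x k a := by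
  have hfin := IsIteratedCommutator.finite x i
  have h1 := (Filter.eventually_all_finite (l := atTop) hfin.finite_subsets
    (p := fun B (K : ℕ) => ∀ g, IsIteratedCommutator x i g →
      g ∈ Subgroup.closure (B ∪ {a | ∃ k, i < k ∧ IsIteratedCommutator x k a}) →
      ∃ l : List G, l.prod = g ∧ l.length ≤ K ∧
        ∀ a ∈ l, a ∈ B ∨ a⁻¹ ∈ B ∨ ∃ k, i < k ∧ IsIteratedCommutator x k a)).2
  refine h1 fun B _ => (Filter.eventually_all_finite hfin).2 fun g _ => ?_
  by_cases hg : g ∈ Subgroup.closure (B ∪ {a | ∃ k, i < k ∧ IsIteratedCommutator x k a})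
  · obtain ⟨l, hl, h⟩ := exists_list_of_mem_closure hg
    filter_upwards [eventually_ge_atTop l.length] with K hK _
    refine ⟨l, hl, hK, fun a ha => ?_⟩
    rcases h a ha with (h | h) | (h | ⟨k, hk, h⟩)
    · exact Or.inl h
    · exact Or.inr (Or.inr h)
    · exact Or.inr (Or.inl h)
    · exact Or.inr (Or.inr ⟨k, hk, inv_inv a ▸ h.inv⟩)
  · exact Eventually.of_forall fun K h => absurd h hg

/-- A commutator with a trivial entry is trivial. So killing some generators either kills an
iterated commutator or leaves it recoverable by `φ`. -/
theorem map_retract {G H ι κ : Type*} [Group G] [Group H] {x : ι → G} {z : κ → H}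
    (ψ : G →* H) (φ : H →* G)
    (h : ∀ i, ψ (x i) = 1 ∨ (∃ j, ψ (x i) = z j) ∧ φ (ψ (x i)) = x i) {n : ℕ} {g : G}
    (hg : IsIteratedCommutator x n g) :
    ψ g = 1 ∨ IsIteratedCommutator z n (ψ g) ∧ φ (ψ g) = g := by
  induction hg with
  | gen i =>
    rcases h i with h | ⟨⟨j, hj⟩, h⟩
    · exact Or.inl h
    · exact Or.inr ⟨hj ▸ gen j, h⟩
  | inv _ ih =>
    rcases ih with ih | ⟨ih, ih'⟩
    · exact Or.inl (by simp [ih])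
    · exact Or.inr ⟨by simpa using ih.inv, by simp [ih']⟩
  | comm _ _ ihg ihh =>
    rcases ihg with ihg | ⟨ihg, ihg'⟩
    · exact Or.inl (by simp [ihg])
    rcases ihh with ihh | ⟨ihh, ihh'⟩
    · exact Or.inl (by simp [ihh])
    · exact Or.inr ⟨by simpa using ihg.comm ihh, by simp [ihg', ihh']⟩

end IsIteratedCommutator

/-! ### Rewriting commutators in a Malcev basis -/

namespace IsMalcevBasis

variable {r c m : ℕ} {wt : Fin m → ℕ} {y : Fin m → FreeNilpotentGroup r c}

open FreeNilpotentGroup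

theorem mem_closure (hy : IsMalcevBasis wt y) {n : ℕ} (hn : n < c) {g : FreeNilpotentGroup r c}
    (hg : g ∈ (⊤ : Subgroup (FreeNilpotentGroup r c)).lowerCentralSeries n) :
    g ∈ Subgroup.closure (y '' {j | wt j = n + 1} ∪
      (⊤ : Subgroup (FreeNilpotentGroup r c)).lowerCentralSeries (n + 1)) := by
  obtain ⟨b, hb⟩ := hy.basis n hn
  set S := Subgroup.closure (y '' {j | wt j = n + 1} ∪
      (⊤ : Subgroup (FreeNilpotentGroup r c)).lowerCentralSeries (n + 1)) with hS
  have key : ∀ q : Additive (LCSFactor (FreeNilpotentGroup r c) n),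
      ∃ s ∈ S, ∃ h : s ∈ (⊤ : Subgroup (FreeNilpotentGroup r c)).lowerCentralSeries n,
        q = Additive.ofMul (QuotientGroup.mk ⟨s, h⟩) := by
    intro q
    have hq : q ∈ AddSubgroup.closure (Set.range b) := by
      have := b.mem_span q
      rwa [← Submodule.mem_toAddSubgroup, Submodule.span_int_eq_addSubgroupClosure] at this
    induction hq using AddSubgroup.closure_induction with
    | mem q hq =>
      obtain ⟨j, rfl⟩ := hq
      obtain ⟨h, hj⟩ := hb j
      exact ⟨y j, Subgroup.subset_closure (Or.inl ⟨j, j.2, rfl⟩), h, hj⟩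
    | zero => exact ⟨1, one_mem _, one_mem _, rfl⟩
    | add _ _ _ _ ih ih' =>
      obtain ⟨s, hs, h, rfl⟩ := ih
      obtain ⟨s', hs', h', rfl⟩ := ih'
      exact ⟨s * s', mul_mem hs hs', mul_mem h h', rfl⟩
    | neg _ _ ih =>
      obtain ⟨s, hs, h, rfl⟩ := ih
      exact ⟨s⁻¹, inv_mem hs, inv_mem h, rfl⟩
  obtain ⟨s, hs, h, hq⟩ := key (Additive.ofMul (QuotientGroup.mk ⟨g, hg⟩))
  have hq' := QuotientGroup.eq.1 (Additive.ofMul.injective hq).symm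
  rw [Subgroup.mem_subgroupOf] at hq'
  have : s⁻¹ * g ∈ S := Subgroup.subset_closure (Or.inr hq')
  simpa using mul_mem hs this

/-- An iterated commutator of weight `i` is a product of boundedly many members of the basis of
weight `i`, their inverses, and iterated commutators of larger weights. -/
theorem exists_list_bound (c : ℕ) : ∃ K : ℕ, ∀ (r m : ℕ) (wt : Fin m → ℕ)
    (y : Fin m → FreeNilpotentGroup r c), IsMalcevBasis wt y →
    ∀ i ≤ c, ∀ g, IsIteratedCommutator (gen c) i g →
      ∃ l : List (FreeNilpotentGroup r c), l.prod = g ∧ l.length ≤ K ∧ ∀ a ∈ l,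
        (∃ j, wt j = i ∧ (a = y j ∨ a = (y j)⁻¹)) ∨
          ∃ k, i < k ∧ IsIteratedCommutator (gen c) k a := by
  -- One `K` for all ranks `k ≤ c` and weights `i ≤ c`.
  obtain ⟨K, hK⟩ := ((Filter.eventually_all_finite (Set.finite_Iic c)).2 fun k _ =>
    (Filter.eventually_all_finite (Set.finite_Iic c)).2 fun i _ =>
      IsIteratedCommutator.exists_length_bound (gen c : Fin k → FreeNilpotentGroup k c) i).exists
  refine ⟨K, fun r m wt y hy i hi g hg => ?_⟩
  obtain ⟨S, hS, hgS⟩ := hg.exists_finset_support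
  let e := S.equivFin
  replace hgS := hgS S.card (fun a => e.symm a) fun a ha => ⟨e ⟨a, ha⟩, by simp⟩
  let φ : FreeNilpotentGroup S.card c →* FreeNilpotentGroup r c :=
    lift lowerCentralSeries_eq_bot fun a => gen c (e.symm a)
  let ψ : FreeNilpotentGroup r c →* FreeNilpotentGroup S.card c :=
    lift lowerCentralSeries_eq_bot fun a => if h : a ∈ S then gen c (e ⟨a, h⟩) else 1
  have hret : ∀ a : Fin r, ψ (gen c a) = 1 ∨ (∃ j, ψ (gen c a) = gen c j) ∧
      φ (ψ (gen c a)) = gen c a := fun a => by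
    by_cases h : a ∈ S
    · exact Or.inr ⟨⟨e ⟨a, h⟩, by simp [ψ, h]⟩, by simp [ψ, φ, h]⟩
    · exact Or.inl (by simp [ψ, h])
  have hψ : ∀ a, ψ (gen c (e.symm a : Fin r)) = gen c a := fun a => by simp [ψ]
  obtain ⟨g', hg', rfl⟩ : ∃ g', IsIteratedCommutator (gen c) i g' ∧ φ g' = g := by
    refine IsIteratedCommutator.exists_of_map φ ?_
    convert hgS using 1
    funext a
    simp [φ]
  have hψφ : ψ (φ g') = g' := by
    have : ψ.comp φ = MonoidHom.id _ := by
      refine MonoidHom.eq_of_eqOn_dense closure_range_gen ?_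
      rintro _ ⟨a, rfl⟩
      simp [φ, hψ]
    exact DFunLike.congr_fun this g'
  -- Dropping trivial images ensures that `φ` carries each member of `B` back to a basis element.
  let B := {b | b ≠ 1 ∧ ∃ j, wt j = i ∧ b = ψ (y j)}
  have hB : B ⊆ {g | IsIteratedCommutator (gen c) i g} := by
    rintro _ ⟨h, j, rfl, rfl⟩
    exact (((hy.isIteratedCommutator j).map_retract ψ φ hret).resolve_left h).1
  have hBφ : ∀ b ∈ B, ∃ j, wt j = i ∧ φ b = y j := by
    rintro _ ⟨h, j, rfl, rfl⟩
    exact ⟨j, rfl, (((hy.isIteratedCommutator j).map_retract ψ φ hret).resolve_left h).2⟩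
  have hcl : g' ∈ Subgroup.closure
      (B ∪ {a | ∃ k, i < k ∧ IsIteratedCommutator (gen c) k a}) := by
    obtain ⟨n, rfl⟩ : ∃ n, i = n + 1 := ⟨i - 1, by have := hg'.one_le; omega⟩
    have h := Subgroup.mem_map_of_mem ψ (hy.mem_closure hi hg.mem_lowerCentralSeries)
    rw [hψφ, MonoidHom.map_closure] at h
    refine (Subgroup.closure_le _).2 ?_ h
    rintro _ ⟨a, ⟨j, hj, rfl⟩ | ha, rfl⟩
    · by_cases h1 : ψ (y j) = 1
      · rw [h1]; exact one_mem _
      · exact Subgroup.subset_closure (Or.inl ⟨h1, j, hj, rfl⟩)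
    · have h2 := Subgroup.mem_map_of_mem ψ ha
      rw [Subgroup.map_lowerCentralSeries] at h2
      exact Subgroup.closure_mono Set.subset_union_right
        (IsIteratedCommutator.lowerCentralSeries_le_closureGE closure_range_gen _
          (Subgroup.lowerCentralSeries_mono _ le_top h2))
  obtain ⟨l, hl, hlK, h⟩ := hK S.card (hS.trans hi) i hi B hB g' hg' hcl
  refine ⟨l.map φ, by rw [← map_list_prod, hl], by simpa using hlK, fun a ha => ?_⟩
  obtain ⟨a, ha', rfl⟩ := List.mem_map.1 ha
  rcases h a ha' with h | h | ⟨k, hk, h⟩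
  · obtain ⟨j, hj, h⟩ := hBφ _ h
    exact Or.inl ⟨j, hj, Or.inl h⟩
  · obtain ⟨j, hj, h⟩ := hBφ _ h
    exact Or.inl ⟨j, hj, Or.inr (by rw [← h]; simp)⟩
  · refine Or.inr ⟨k, hk, IsIteratedCommutator.of_comp (e := fun a => (e.symm a : Fin r)) ?_⟩
    convert h.map φ using 1
    funext a
    simp [φ]

end IsMalcevBasis

/-! ### Ordered products of powers -/

section Ordered

variable {G : Type*} [Group G]

theorem List.prod_ofFn_zpow_zero {m : ℕ} (y : Fin m → G) :
    (List.ofFn fun j => y j ^ (0 : Fin m → ℤ) j).prod = 1 := by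
  simp

/-- The supports share at most one index, so the products merge without commuting distinct factors.
-/
theorem List.prod_ofFn_zpow_mul {m : ℕ} (y : Fin m → G) (α β : Fin m → ℤ)
    (h : ∀ j j', α j ≠ 0 → β j' ≠ 0 → j ≤ j') :
    (List.ofFn fun j => y j ^ α j).prod * (List.ofFn fun j => y j ^ β j).prod =
      (List.ofFn fun j => y j ^ (α + β) j).prod := by
  induction m with
  | zero => simp
  | succ m ih =>
    have ih := ih (fun j => y j.succ) (fun j => α j.succ) (fun j => β j.succ)
      fun j j' hj hj' => Fin.succ_le_succ_iff.1 (h _ _ hj hj')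
    simp only [List.ofFn_succ, List.prod_cons, Pi.add_apply] at ih ⊢
    by_cases h0 : β 0 = 0
    · rw [h0, zpow_zero, one_mul, add_zero, mul_assoc, ih]
    · have hα : ∀ j : Fin m, α j.succ = 0 := fun j => by
        by_contra hj
        exact absurd (h _ _ hj h0) (by simp)
      simp [hα, zpow_add, mul_assoc]

theorem List.prod_ofFn_zpow_single {m : ℕ} (y : Fin m → G) (j : Fin m) (a : ℤ) :
    (List.ofFn fun i => y i ^ (Pi.single j a : Fin m → ℤ) i).prod = y j ^ a := by
  induction m with
  | zero => exact j.elim0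
  | succ m ih =>
    rw [List.ofFn_succ, List.prod_cons]
    refine Fin.cases ?_ (fun j => ?_) j
    · simp
    · have := ih (fun i => y i.succ) j
      simp only [Pi.single_apply, Fin.succ_inj] at this ⊢
      simpa [(Fin.succ_ne_zero j).symm] using this

end Ordered

/-! ### The weighted charge of a list -/

section WeightCost

variable {G : Type*}

/-- The sum of `B ^ (-k)` over the weights `k` of a list of weighted elements. -/
noncomputable def weightCost (B : ℝ) (l : List (ℕ × G)) : ℝ :=
  (l.map fun a => (B ^ a.1)⁻¹).sum

theorem weightCost_le_length {B : ℝ} (hB : 1 ≤ B) (l : List (ℕ × G)) :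
    weightCost B l ≤ l.length := by
  induction l with
  | nil => simp [weightCost]
  | cons a l ih =>
    simp only [weightCost, List.map_cons, List.sum_cons, List.length_cons] at ih ⊢
    have : (B ^ a.1)⁻¹ ≤ 1 := inv_le_one_of_one_le₀ (one_le_pow₀ hB)
    push_cast
    linarith

theorem length_le_weightCost {B : ℝ} (hB : 1 ≤ B) {c : ℕ} (l : List (ℕ × G))
    (hl : ∀ a ∈ l, a.1 ≤ c) : l.length ≤ B ^ c * weightCost B l := by
  induction l with
  | nil => simp [weightCost]
  | cons a l ih =>
    have ih := ih fun b hb => hl b (by simp [hb])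
    simp only [weightCost, List.map_cons, List.sum_cons, List.length_cons] at ih ⊢
    have hB0 : 0 < B := by linarith
    have : 1 ≤ B ^ c * (B ^ a.1)⁻¹ := by
      rw [← div_eq_mul_inv, one_le_div (by positivity)]
      exact pow_le_pow_right₀ hB (hl a (by simp))
    push_cast
    linarith

theorem weightCost_filter_le {B : ℝ} (hB : 1 ≤ B) (p : ℕ × G → Bool) (l : List (ℕ × G)) :
    weightCost B (l.filter p) ≤ weightCost B l := by
  have hB0 : 0 < B := by linarith
  refine List.Sublist.sum_le_sum (List.filter_sublist.map _) fun b hb => ?_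
  obtain ⟨b, _, rfl⟩ := List.mem_map.1 hb
  positivity

end WeightCost

/-! ### The collection process -/

section Collect

variable {G ι : Type*} [Group G] {x : ι → G}

/-- Moving an iterated commutator of weight `i` to the front of a product of iterated commutators
of weights at least `i` only inserts iterated commutators of weights larger than `i`. -/
theorem exists_move_front {B : ℝ} (hB : 1 ≤ B) {i : ℕ} {g : G}
    (hg : IsIteratedCommutator x i g) (l : List (ℕ × G))
    (hl : ∀ a ∈ l, IsIteratedCommutator x a.1 a.2 ∧ i ≤ a.1) :
    ∃ l' : List (ℕ × G), (l.map Prod.snd).prod * g = g * (l'.map Prod.snd).prod ∧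
      (∀ a ∈ l', IsIteratedCommutator x a.1 a.2 ∧ i ≤ a.1) ∧
      l'.filter (fun a => a.1 = i) = l.filter (fun a => a.1 = i) ∧
      weightCost B l' ≤ weightCost B l * (1 + B⁻¹) := by
  have hi := hg.one_le
  induction l with
  | nil => exact ⟨[], by simp, by simp, by simp, by simp [weightCost]⟩
  | cons a l ih =>
    obtain ⟨l', h1, h2, h3, h4⟩ := ih fun b hb => hl b (by simp [hb])
    obtain ⟨ha, hia⟩ := hl a (by simp)
    -- This is `a g = g a [a⁻¹, g⁻¹]`. Since `i ≥ 1`, the new letter has larger weight and costs at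
    -- most `B⁻¹` times the charge of `a`.
    refine ⟨(a.1, a.2) :: (a.1 + i, a.2⁻¹ * g⁻¹ * a.2⁻¹⁻¹ * g⁻¹⁻¹) :: l', ?_, ?_, ?_, ?_⟩
    · simp only [List.map_cons, List.prod_cons, mul_assoc, h1]
      group
    · simp only [List.mem_cons, forall_eq_or_imp]
      exact ⟨⟨ha, hia⟩, ⟨ha.inv.comm hg.inv, by omega⟩, h2⟩
    · rw [List.filter_cons, List.filter_cons (x := (a.1 + i, _)), h3, List.filter_cons]
      have : a.1 ≠ 0 := by omega
      simp [this]
    · simp only [weightCost, List.map_cons, List.sum_cons] at h4 ⊢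
      have hB0 : 0 < B := by linarith
      have : (B ^ (a.1 + i))⁻¹ ≤ (B ^ a.1)⁻¹ * B⁻¹ := by
        rw [← mul_inv, ← pow_succ]
        exact inv_anti₀ (by positivity) (pow_le_pow_right₀ hB (by omega))
      linarith

/-- Collection of the letters of weight `i`, all of them members of the ordered list `y` or their
inverses, to the front of a product of iterated commutators. -/
theorem exists_collect {m : ℕ} {y : Fin m → G} {B : ℝ} (hB : 1 ≤ B) (i : ℕ) (M : ℕ)
    (l : List (ℕ × G)) (hl : ∀ a ∈ l, IsIteratedCommutator x a.1 a.2 ∧ i ≤ a.1)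
    (s : Set (Fin m))
    (hy' : ∀ a ∈ l, a.1 = i → ∃ j ∈ s, a.2 = y j ∨ a.2 = (y j)⁻¹)
    (hM : (l.filter fun a => a.1 = i).length = M) :
    ∃ (α : Fin m → ℤ) (l' : List (ℕ × G)),
      (l.map Prod.snd).prod = (List.ofFn fun j => y j ^ α j).prod * (l'.map Prod.snd).prod ∧
      (∀ j, α j ≠ 0 → j ∈ s) ∧ (∀ j, |α j| ≤ M) ∧
      (∀ a ∈ l', IsIteratedCommutator x a.1 a.2 ∧ i + 1 ≤ a.1) ∧
      weightCost B l' ≤ weightCost B l * (1 + B⁻¹) ^ M := by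
  induction M generalizing l s with
  | zero =>
    refine ⟨0, l, by simp, by simp, by simp, fun a ha => ⟨(hl a ha).1, ?_⟩, by simp⟩
    have h := List.eq_nil_of_length_eq_zero hM
    rw [List.filter_eq_nil_iff] at h
    have h1 := h a ha
    have h2 := (hl a ha).2
    simp only [decide_eq_true_eq] at h1
    omega
  | succ M ih =>
    classical
    -- The indices still present at weight `i`. Extracting a letter of least index keeps the
    -- collected product ordered.
    let T : Finset (Fin m) :=
      {j | j ∈ s ∧ ∃ a ∈ l, a.1 = i ∧ (a.2 = y j ∨ a.2 = (y j)⁻¹)}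
    have hT : T.Nonempty := by
      obtain ⟨a, ha⟩ := List.exists_mem_of_length_pos (by rw [hM]; exact M.succ_pos)
      simp only [List.mem_filter, decide_eq_true_eq] at ha
      obtain ⟨j, hj, h⟩ := hy' a ha.1 ha.2
      exact ⟨j, Finset.mem_filter.2 ⟨Finset.mem_univ _, hj, a, ha.1, ha.2, h⟩⟩
    obtain ⟨hj, a, ha, hai, haj⟩ := (Finset.mem_filter.1 (T.min'_mem hT)).2
    set j := T.min' hT
    obtain ⟨l₁, l₂, rfl⟩ := List.append_of_mem ha
    obtain ⟨l₁', h1, h2, h3, h4⟩ := exists_move_front hB (hai ▸ (hl a ha).1) l₁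
      fun b hb => hl b (by simp [hb])
    have hmem : ∀ b ∈ l₁' ++ l₂, b.1 = i → b ∈ l₁ ++ a :: l₂ := by
      intro b hb hbi
      rcases List.mem_append.1 hb with hb | hb
      · have : b ∈ l₁'.filter (fun a => a.1 = i) := by simp [hb, hbi]
        rw [h3] at this
        simp [List.mem_of_mem_filter this]
      · simp [hb]
    -- Restricting `s` to indices from `j` on records that all later letters belong to the right of,
    -- or merge with, the power of `y j`.
    obtain ⟨α, l', h5, h6, h7, h8, h9⟩ := ih (l₁' ++ l₂)
      (fun b hb => (List.mem_append.1 hb).elim (h2 b) fun hb => hl b (by simp [hb])) {k ∈ s | j ≤ k}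
      (fun b hb hbi => by
        obtain ⟨k, hk, h⟩ := hy' b (hmem b hb hbi) hbi
        exact ⟨k, ⟨hk, T.min'_le k (Finset.mem_filter.2
          ⟨Finset.mem_univ _, hk, b, hmem b hb hbi, hbi, h⟩)⟩, h⟩)
      (by
        rw [List.filter_append, h3]
        rw [List.filter_append, List.filter_cons] at hM
        simp [hai] at hM
        simp
        omega)
    obtain ⟨ε, hε, hε'⟩ : ∃ ε : ℤ, |ε| ≤ 1 ∧ a.2 = y j ^ ε := by
      rcases haj with h | h
      · exact ⟨1, by simp, by simpa using h⟩
      · exact ⟨-1, by simp, by simpa using h⟩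
    refine ⟨Pi.single j ε + α, l', ?_, fun k hk => ?_, fun k => ?_, h8, ?_⟩
    · rw [← List.prod_ofFn_zpow_mul, List.prod_ofFn_zpow_single, mul_assoc, ← h5, ← hε']
      · simp only [List.map_append, List.prod_append, List.map_cons, List.prod_cons, ← mul_assoc,
          h1]
      · intro k k' hk hk'
        obtain rfl : k = j := by
          by_contra h
          exact hk (Pi.single_eq_of_ne h _)
        exact (h6 k' hk').2
    · by_cases h : k = j
      · exact h ▸ hj
      · refine (h6 k ?_).1
        simpa [Pi.single_eq_of_ne h] using hk
    · rw [Pi.add_apply]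
      have := h7 k
      have h' : |(Pi.single j ε : Fin m → ℤ) k| ≤ 1 := by
        by_cases h : k = j
        · subst h; simpa using hε
        · simp [Pi.single_eq_of_ne h]
      push_cast
      linarith [abs_add_le ((Pi.single j ε : Fin m → ℤ) k) (α k)]
    · refine h9.trans ?_
      rw [pow_succ', ← mul_assoc]
      have hB0 : 0 < B := by linarith
      gcongr
      have hl₂ : 0 ≤ (l₂.map fun a => (B ^ a.1)⁻¹).sum :=
        List.sum_nonneg fun b hb => by
          obtain ⟨b, _, rfl⟩ := List.mem_map.1 hb
          positivity
      have : 0 ≤ (B ^ a.1)⁻¹ := by positivity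
      simp only [weightCost, List.map_append, List.sum_append, List.map_cons, List.sum_cons] at h4 ⊢
      have : 0 ≤ B⁻¹ := by positivity
      nlinarith

end Collect

/-! ### Assembling the polynomial bound -/

theorem Polynomial.eval_mono_nat (p : Polynomial ℕ) : Monotone fun n => p.eval n := by
  intro a b hab
  simp only [Polynomial.eval_eq_sum, Polynomial.sum]
  gcongr

theorem one_add_inv_pow_le_three {B : ℝ} (hB : 0 < B) {n : ℕ} (hn : n ≤ B) :
    (1 + B⁻¹) ^ n ≤ 3 := by
  have h1 : 1 + B⁻¹ ≤ Real.exp B⁻¹ := by linarith [Real.add_one_le_exp B⁻¹]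
  calc (1 + B⁻¹) ^ n ≤ Real.exp B⁻¹ ^ n := by gcongr
    _ = Real.exp (n * B⁻¹) := by rw [Real.exp_nat_mul]
    _ ≤ Real.exp 1 := by
      gcongr
      rwa [← div_eq_mul_inv, div_le_one hB]
    _ ≤ 3 := by linarith [Real.exp_one_lt_d9]

open FreeNilpotentGroup

theorem prod_filter_weight_le {r c : ℕ} (l : List (ℕ × FreeNilpotentGroup r c))
    (hl : ∀ a ∈ l, IsIteratedCommutator (gen c) a.1 a.2) :
    ((l.filter fun a => a.1 ≤ c).map Prod.snd).prod = (l.map Prod.snd).prod := by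
  induction l with
  | nil => simp
  | cons a l ih =>
    have ih := ih fun b hb => hl b (by simp [hb])
    by_cases h : a.1 ≤ c
    · simp [h, ih]
    · have := (hl a (by simp)).eq_one_of_lt lowerCentralSeries_eq_bot (not_le.1 h)
      simp [h, ih, this]

/-- Writing the members of weight `i` of a product of iterated commutators in terms of the given
basis. -/
theorem exists_rewrite_weight {r c m K i : ℕ} {wt : Fin m → ℕ} {y : Fin m → FreeNilpotentGroup r c}
    (hy : ∀ j, IsIteratedCommutator (gen c) (wt j) (y j))
    (hK : ∀ g, IsIteratedCommutator (gen c) i g →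
      ∃ l : List (FreeNilpotentGroup r c), l.prod = g ∧ l.length ≤ K ∧ ∀ a ∈ l,
        (∃ j, wt j = i ∧ (a = y j ∨ a = (y j)⁻¹)) ∨
          ∃ k, i < k ∧ IsIteratedCommutator (gen c) k a)
    (l : List (ℕ × FreeNilpotentGroup r c))
    (hl : ∀ a ∈ l, IsIteratedCommutator (gen c) a.1 a.2 ∧ i ≤ a.1) :
    ∃ l' : List (ℕ × FreeNilpotentGroup r c),
      (l'.map Prod.snd).prod = (l.map Prod.snd).prod ∧ l'.length ≤ (K + 1) * l.length ∧
      (∀ a ∈ l', IsIteratedCommutator (gen c) a.1 a.2 ∧ i ≤ a.1) ∧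
      ∀ a ∈ l', a.1 = i → ∃ j ∈ {j | wt j = i}, a.2 = y j ∨ a.2 = (y j)⁻¹ := by
  have hweight : ∀ l : List (FreeNilpotentGroup r c), (∀ a ∈ l,
      (∃ j, wt j = i ∧ (a = y j ∨ a = (y j)⁻¹)) ∨
        ∃ k, i < k ∧ IsIteratedCommutator (gen c) k a) →
      ∃ l' : List (ℕ × FreeNilpotentGroup r c), l'.map Prod.snd = l ∧
        (∀ a ∈ l', IsIteratedCommutator (gen c) a.1 a.2 ∧ i ≤ a.1) ∧
        ∀ a ∈ l', a.1 = i → ∃ j ∈ {j | wt j = i}, a.2 = y j ∨ a.2 = (y j)⁻¹ := by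
    intro l hl
    induction l with
    | nil => exact ⟨[], by simp⟩
    | cons a l ih =>
      obtain ⟨l', h1, h2, h3⟩ := ih fun b hb => hl b (by simp [hb])
      rcases hl a (by simp) with ⟨j, hj, h⟩ | ⟨k, hk, h⟩
      · refine ⟨(i, a) :: l', by simp [h1], ?_, ?_⟩
        · simp only [List.mem_cons, forall_eq_or_imp]
          refine ⟨⟨?_, le_rfl⟩, h2⟩
          rcases h with rfl | rfl
          · exact hj ▸ hy j
          · exact hj ▸ (hy j).inv
        · simp only [List.mem_cons, forall_eq_or_imp]
          exact ⟨fun _ => ⟨j, hj, h⟩, h3⟩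
      · refine ⟨(k, a) :: l', by simp [h1], ?_, ?_⟩
        · simp only [List.mem_cons, forall_eq_or_imp]
          exact ⟨⟨h, hk.le⟩, h2⟩
        · simp only [List.mem_cons, forall_eq_or_imp]
          exact ⟨fun h => absurd h hk.ne', h3⟩
  induction l with
  | nil => exact ⟨[], by simp⟩
  | cons a l ih =>
    obtain ⟨l', h1, h2, h3, h4⟩ := ih fun b hb => hl b (by simp [hb])
    obtain ⟨ha, hia⟩ := hl a (by simp)
    -- A letter becomes at most `K` letters or stays alone; `K + 1` covers both cases.
    rcases hia.eq_or_lt with rfl | hia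
    · obtain ⟨u, hu, huK, hu'⟩ := hK a.2 ha
      obtain ⟨u', rfl, h5, h6⟩ := hweight u hu'
      refine ⟨u' ++ l', by simp [hu, h1], ?_, ?_, ?_⟩
      · rw [List.length_map] at huK
        simp only [List.length_append, List.length_cons]
        linarith
      · exact fun b hb => (List.mem_append.1 hb).elim (h5 b) (h3 b)
      · exact fun b hb => (List.mem_append.1 hb).elim (h6 b) (h4 b)
    · refine ⟨a :: l', by simp [h1], ?_, ?_, ?_⟩
      · simp only [List.length_cons]
        linarith
      · simp only [List.mem_cons, forall_eq_or_imp]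
        exact ⟨⟨ha, hia.le⟩, h3⟩
      · simp only [List.mem_cons, forall_eq_or_imp]
        exact ⟨fun h => absurd h hia.ne', h4⟩

/-- Polynomial bounds for the exponents of a product of iterated commutators of weights at
least `i`. -/
theorem exists_polynomial_bound (c k i : ℕ) (hi : i + k = c + 1) :
    ∃ P : Polynomial ℕ, ∀ (r m : ℕ) (wt : Fin m → ℕ) (y : Fin m → FreeNilpotentGroup r c),
      IsMalcevBasis wt y → ∀ l : List (ℕ × FreeNilpotentGroup r c),
        (∀ a ∈ l, IsIteratedCommutator (gen c) a.1 a.2 ∧ i ≤ a.1) →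
        ∃ α : Fin m → ℤ, (l.map Prod.snd).prod = (List.ofFn fun j => y j ^ α j).prod ∧
          (∀ j, α j ≠ 0 → i ≤ wt j) ∧ ∀ j, |α j| ≤ (P.eval l.length : ℕ) := by
  induction k generalizing i with
  | zero =>
    refine ⟨0, fun r m wt y _ l hl => ⟨0, ?_, by simp, by simp⟩⟩
    rw [List.prod_ofFn_zpow_zero, ← prod_filter_weight_le l fun a ha => (hl a ha).1]
    rw [List.filter_eq_nil_iff.2, List.map_nil, List.prod_nil]
    intro a ha
    have := (hl a ha).2
    simp only [decide_eq_true_eq]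
    omega
  | succ k ih =>
    obtain ⟨P, hP⟩ := ih (i + 1) (by omega)
    obtain ⟨K, hK⟩ := IsMalcevBasis.exists_list_bound c
    -- `Q` bounds the length after rewriting, and the `+ 1` makes its value a valid base `B ≥ 1`.
    -- With this base the charge is at most `3B` after collection, so at most `3 * B ^ (c + 1)`
    -- letters of weight at most `c` remain.
    let Q : Polynomial ℕ := ((K + 1 : ℕ) : Polynomial ℕ) * Polynomial.X + 1
    refine ⟨Q + P.comp (3 * Q ^ (c + 1)), fun r m wt y hy l hl => ?_⟩
    obtain ⟨l₁, h1, h2, h3, h4⟩ := exists_rewrite_weight hy.isIteratedCommutator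
      (hK r m wt y hy i (by omega)) l hl
    set b := (K + 1) * l.length + 1 with hb
    have hB : (1 : ℝ) ≤ b := by rw [hb]; exact_mod_cast Nat.le_add_left 1 _
    obtain ⟨α, l₂, h5, h6, h7, h8, h9⟩ := exists_collect hB i _ l₁ h3 {j | wt j = i} h4 rfl
    have hM : (l₁.filter fun a => a.1 = i).length ≤ b :=
      (List.length_filter_le _ _).trans (h2.trans (Nat.le_succ _))
    obtain ⟨β, h10, h11, h12⟩ := hP r m wt y hy (l₂.filter fun a => a.1 ≤ c)
      fun a ha => h8 a (List.mem_of_mem_filter ha)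
    rw [prod_filter_weight_le l₂ fun a ha => (h8 a ha).1] at h10
    have hlen : (l₂.filter fun a => a.1 ≤ c).length ≤ 3 * b ^ (c + 1) := by
      have hb0 : (0 : ℝ) ≤ b := by linarith
      have h13 : weightCost b l₂ ≤ b * 3 := by
        refine h9.trans (mul_le_mul ((weightCost_le_length hB l₁).trans ?_)
          (one_add_inv_pow_le_three (by linarith) (by exact_mod_cast hM)) (by positivity) hb0)
        exact_mod_cast h2.trans (Nat.le_succ _)
      have h14 := (length_le_weightCost hB (c := c) (l₂.filter fun a => a.1 ≤ c)
        (fun a ha => by simpa using (List.mem_filter.1 ha).2)).trans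
        (mul_le_mul_of_nonneg_left ((weightCost_filter_le hB _ _).trans h13) (by positivity))
      have h15 : (b : ℝ) ^ c * (b * 3) = ((3 * b ^ (c + 1) : ℕ) : ℝ) := by push_cast; ring
      rw [h15] at h14
      exact_mod_cast h14
    have hQ : Q.eval l.length = b := by simp [Q, hb]
    have hPlen : P.eval _ ≤ P.eval _ := P.eval_mono_nat hlen
    refine ⟨α + β, ?_, fun j hj => ?_, fun j => ?_⟩
    · rw [← h1, h5, h10, List.prod_ofFn_zpow_mul]
      intro j j' hj hj'
      have hj := h6 j hj
      have hj' := h11 j' hj'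
      by_contra h
      have := hy.monotone_wt (not_le.1 h).le
      rw [Set.mem_ofPred_eq] at hj
      omega
    · by_cases h : α j = 0
      · have := h11 j (by simpa [h] using hj)
        omega
      · exact (h6 j h).ge
    · have h13 := h7 j
      have h14 := h12 j
      rw [Polynomial.eval_add, Polynomial.eval_comp, Polynomial.eval_mul, Polynomial.eval_pow,
        hQ, show (3 : Polynomial ℕ).eval l.length = 3 from Polynomial.eval_natCast, Pi.add_apply]
      have := abs_add_le (α j) (β j)
      have hM' := Int.ofNat_le.2 hM
      have hPlen' := Int.ofNat_le.2 hPlen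
      push_cast
      linarith

theorem mainTheorem5 (c : ℕ) (hc : 1 ≤ c) :
    ∃ P : Polynomial ℤ, ∀ (r m : ℕ) (wt : Fin m → ℕ) (y : Fin m → FreeNilpotentGroup r c),
      IsMalcevBasis wt y →
      ∀ w : List (Fin r × Bool), ∃ α : Fin m → ℤ,
        FreeNilpotentGroup.ofWord c w = (List.ofFn fun j => y j ^ α j).prod ∧
        ∀ j, |α j| ≤ P.eval (w.length : ℤ) := by
  obtain ⟨P, hP⟩ := exists_polynomial_bound c c 1 (by omega)
  refine ⟨P.map (Nat.castRingHom ℤ), fun r m wt y hy w => ?_⟩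
  obtain ⟨l, h1, h2, h3⟩ : ∃ l : List (ℕ × FreeNilpotentGroup r c),
      (l.map Prod.snd).prod = ofWord c w ∧ l.length = w.length ∧
      ∀ a ∈ l, IsIteratedCommutator (gen c) a.1 a.2 ∧ 1 ≤ a.1 := by
    induction w with
    | nil => exact ⟨[], rfl, rfl, by simp⟩
    | cons a w ih =>
      obtain ⟨l, h1, h2, h3⟩ := ih
      have ha : IsIteratedCommutator (gen c) 1 (ofWord c [a]) := by
        obtain ⟨i, _ | _⟩ := a
        · exact (IsIteratedCommutator.gen (x := gen c) i).inv
        · exact IsIteratedCommutator.gen (x := gen c) i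
      refine ⟨(1, ofWord c [a]) :: l, ?_, by simp [h2], ?_⟩
      · rw [List.map_cons, List.prod_cons, h1]
        rfl
      · simp only [List.mem_cons, forall_eq_or_imp]
        exact ⟨⟨ha, le_rfl⟩, h3⟩
  obtain ⟨α, h4, -, h5⟩ := hP r m wt y hy l h3
  refine ⟨α, h1 ▸ h4, fun j => (h5 j).trans_eq ?_⟩
  rw [h2, Polynomial.eval_natCast_map]
  rfl
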